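/- **Setting.** Let $A$ be an associative unital $\mathbb{Q}$-algebra, $X_1,\dots,X_n\in A$, $[a,b]=ab-ba$ and $\mathrm{ad}_a b=[a,b]$. Work with formal power series in a central variable $t$ with coefficients in $A$. The exponents $W_2,W_3,\dots\in A$ of the multivariable Zassenhaus formula are defined by $$e^{t(X_1+\cdots+X_n)}=e^{tX_1}e^{tX_2}\cdots e^{tX_n}\,e^{t^2W_2}e^{t^3W_3}e^{t^4W_4}\cdots .$$ Put $R_1(t)=e^{-tX_n}\cdots e^{-tX_1}e^{t(X_1+\cdots+X_n)}$, $R_m(t)=e^{-t^mW_m}R_{m-1}(t)$ for $m\ge 2$, and let $f_{m,k}\in A$ be the coefficient of $t^k$ in $F_m(t)=R_m'(t)R_m(t)^{-1}$, $m\ge1$. **Theorem 3.2.** The exponents $W_m$ ($m\ge2$) exist and are unique, and the following hold. (a) For $m\ge 2$ and $k\ge m$, $\displaystyle f_{m,k}=\sum_{j=0}^{\lfloor k/m\rfloor-1}\frac{(-1)^j}{j!}\,\mathrm{ad}_{W_m}^j f_{m-1,k-mj}$; and $W_m=\frac1m f_{\lfloor (m-1)/2\rfloor,\,m-1}$ for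 $m\ge5$. (b) Low degrees: \begin{align*} W_6&=\tfrac16\big(f_{1,5}-\mathrm{ad}_{W_2}f_{1,3}\big),\\ W_7&=\tfrac17\big(f_{1,6}-\mathrm{ad}_{W_2}f_{1,4}+\tfrac1{2!}\mathrm{ad}_{W_2}^2f_{1,2}-\mathrm{ad}_{W_3}f_{1,3}\big),\\ W_8&=\tfrac18\big(f_{1,7}-\mathrm{ad}_{W_2}f_{1,5}+\tfrac1{2!}\mathrm{ad}_{W_2}^2f_{1,3}-\mathrm{ad}_{W_3}f_{1,4}+\mathrm{ad}_{W_3}\mathrm{ad}_{W_2}f_{1,2}\big),\\ W_9&=\tfrac19\big(f_{1,8}-\mathrm{ad}_{W_2}f_{1,6}+\tfrac1{2!}\mathrm{ad}_{W_2}^2f_{1,4}-\tfrac1{3!}\mathrm{ad}_{W_2}^3f_{1,2}-\mathrm{ad}_{W_3}f_{1,5}\\ &\qquad+\mathrm{ad}_{W_3}\mathrm{ad}_{W_2}f_{1,3}-\mathrm{ad}_{W_4}f_{1,4}+\mathrm{ad}_{W_4}\mathrm{ad}_{W_2}f_{1,2}\big),\\ W_{10}&=\tfrac1{10}\big(f_{1,9}-\mathrm{ad}_{W_2}f_{1,7}+\tfrac1{2!}\mathrm{ad}_{W_2}^2f_{1,5}-\tfrac1{3!}\mathrm{ad}_{W_2}^3f_{1,3}-\mathrm{ad}_{W_3}f_{1,6}+\mathrm{ad}_{W_3}\mathrm{ad}_{W_2}f_{1,4}\\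 &\qquad-\tfrac1{2!}\mathrm{ad}_{W_3}\mathrm{ad}_{W_2}^2f_{1,2}+\tfrac1{2!}\mathrm{ad}_{W_3}^2f_{1,3}-\mathrm{ad}_{W_4}f_{1,5}+\mathrm{ad}_{W_4}\mathrm{ad}_{W_2}f_{1,3}\big). \end{align*} (c) For every $k\ge2$ (empty sums being zero): \begin{align*} W_{6k}&=\tfrac1{6k}\Big(f_{2k-2,6k-1}-\mathrm{ad}_{W_{2k-1}}f_{2k-2,4k}+\tfrac1{2!}\mathrm{ad}_{W_{2k-1}}^2f_{2k-2,2k+1}-\mathrm{ad}_{W_{2k}}f_{2k-2,4k-1}\\ &\quad+\mathrm{ad}_{W_{2k}}\mathrm{ad}_{W_{2k-1}}f_{2k-2,2k}-\mathrm{ad}_{W_{2k+1}}f_{2k-2,4k-2}+\mathrm{ad}_{W_{2k+1}}\mathrm{ad}_{W_{2k-1}}f_{2k-2,2k-1}\\ &\quad-\sum_{p=2k+2}^{3k-1}\mathrm{ad}_{W_p}f_{2k-2,6k-1-p}\Big),\\ W_{6k+1}&=\tfrac1{6k+1}\Big(f_{2k-1,6k}-\mathrm{ad}_{W_{2k}}f_{2k-1,4k}+\tfrac1{2!}\mathrm{ad}_{W_{2k}}^2f_{2k-1,2k}-\mathrm{ad}_{W_{2k+1}}f_{2k-1,4k-1}\\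 &\quad-\sum_{p=2k+2}^{3k}\mathrm{ad}_{W_p}f_{2k-1,6k-p}\Big),\\ W_{6k+2}&=\tfrac1{6k+2}\Big(f_{2k-1,6k+1}-\mathrm{ad}_{W_{2k}}f_{2k-1,4k+1}+\tfrac1{2!}\mathrm{ad}_{W_{2k}}^2f_{2k-1,2k+1}-\mathrm{ad}_{W_{2k+1}}f_{2k-1,4k}\\ &\quad+\mathrm{ad}_{W_{2k+1}}\mathrm{ad}_{W_{2k}}f_{2k-1,2k}-\sum_{p=2k+2}^{3k}\mathrm{ad}_{W_p}f_{2k-1,6k+1-p}\Big),\\ W_{6k+3}&=\tfrac1{6k+3}\Big(f_{2k-1,6k+2}-\mathrm{ad}_{W_{2k}}f_{2k-1,4k+2}+\tfrac1{2!}\mathrm{ad}_{W_{2k}}^2f_{2k-1,2k+2}-\mathrm{ad}_{W_{2k+1}}f_{2k-1,4k+1}\\ &\quad+\mathrm{ad}_{W_{2k+1}}\mathrm{ad}_{W_{2k}}f_{2k-1,2k+1}-\mathrm{ad}_{W_{2k+2}}f_{2k-1,4k}+\mathrm{ad}_{W_{2k+2}}\mathrm{ad}_{W_{2k}}f_{2k-1,2k}\\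 &\quad-\sum_{p=2k+3}^{3k+1}\mathrm{ad}_{W_p}f_{2k-1,6k+2-p}\Big),\\ W_{6k+4}&=\tfrac1{6k+4}\Big(f_{2k,6k+3}-\mathrm{ad}_{W_{2k+1}}f_{2k,4k+2}+\tfrac1{2!}\mathrm{ad}_{W_{2k+1}}^2f_{2k,2k+1}-\mathrm{ad}_{W_{2k+2}}f_{2k,4k+1}\\ &\quad-\sum_{p=2k+3}^{3k+1}\mathrm{ad}_{W_p}f_{2k,6k+3-p}\Big),\\ W_{6k+5}&=\tfrac1{6k+5}\Big(f_{2k,6k+4}-\mathrm{ad}_{W_{2k+1}}f_{2k,4k+3}+\tfrac1{2!}\mathrm{ad}_{W_{2k+1}}^2f_{2k,2k+2}-\mathrm{ad}_{W_{2k+2}}f_{2k,4k+2}\\ &\quad+\mathrm{ad}_{W_{2k+2}}\mathrm{ad}_{W_{2k+1}}f_{2k,2k+1}-\sum_{p=2k+3}^{3k+2}\mathrm{ad}_{W_p}f_{2k,6k+4-p}\Big). \end{align*} (d) Consequently every $W_m$ is expressed through the $f_{1,k}$: for each $m\ge2$ there is a Lie polynomial $P_m$ with rational coefficients in $m-1$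 variables, depending only on $m$ (not on $A$, $n$ or the $X_i$), such that $W_m=P_m(f_{1,1},\dots,f_{1,m-1})$. -/

import Mathlib

/-! Formal power series in a central variable `t` with coefficients in a (noncommutative)
`ℚ`-algebra `A`, i.e. elements of `PowerSeries A`. -/

universe u

/- The Lie bracket of an associative ring is the commutator `[a, b] = a b - b a`. -/
attribute [local instance 100] LieRing.ofAssociativeRing

namespace Zassenhaus

open Filter

noncomputable section

/-- The exponential `e^{t^m a} = ∑_j (a^j / j!) t^{m j}` (used for `m ≥ 1`). -/
def expT {A : Type u} [Ring A] [Algebra ℚ A] (m : ℕ) (a : A) : PowerSeries A :=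
  PowerSeries.mk fun k => if m ∣ k then (1 / ((k / m).factorial : ℚ)) • a ^ (k / m) else 0

/-- The formal derivative `d/dt` (coefficients need not commute). -/
def derivT {A : Type u} [Ring A] (G : PowerSeries A) : PowerSeries A :=
  PowerSeries.mk fun k => (k + 1) • PowerSeries.coeff (k + 1) G

/-- `W` is a sequence of exponents of the multivariable Zassenhaus formula for `X₁, …, Xₙ`:
`e^{t(X₁+⋯+Xₙ)} = e^{tX₁} ⋯ e^{tXₙ} e^{t²W₂} e^{t³W₃} ⋯`, where the infinite ordered product is
the `t`-adic limit of its finite partial products (every coefficient is eventually constant).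
The values `W 0` and `W 1` play no role. -/
def IsExponents {A : Type u} [Ring A] [Algebra ℚ A] {n : ℕ} (X : Fin n → A) (W : ℕ → A) : Prop :=
  ∀ k : ℕ, ∀ᶠ N in atTop,
    PowerSeries.coeff k
        ((List.ofFn fun i => expT 1 (X i)).prod *
          ((List.range N).map fun j => expT (j + 2) (W (j + 2))).prod) =
      PowerSeries.coeff k (expT 1 (∑ i, X i))

/-- `R₁(t) = e^{-tXₙ} ⋯ e^{-tX₁} e^{t(X₁+⋯+Xₙ)}` and `R_m(t) = e^{-t^m W_m} R_{m-1}(t)` for `m ≥ 2`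
(`R₀` is a dummy value). -/
def R {A : Type u} [Ring A] [Algebra ℚ A] {n : ℕ} (X : Fin n → A) (W : ℕ → A) :
    ℕ → PowerSeries A
  | 0 => 1
  | 1 => (List.ofFn fun i => expT 1 (-X i)).reverse.prod * expT 1 (∑ i, X i)
  | m + 2 => expT (m + 2) (-W (m + 2)) * R X W (m + 1)

/-- The logarithmic derivative `F_m(t) = R_m'(t) R_m(t)⁻¹`. Each `R_m(t)` is invertible, and
`Ring.inverse` is the two-sided inverse. -/
def F {A : Type u} [Ring A] [Algebra ℚ A] {n : ℕ} (X : Fin n → A) (W : ℕ → A) (m : ℕ) :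
    PowerSeries A :=
  derivT (R X W m) * Ring.inverse (R X W m)

/-- The coefficient `f_{m,k}` of `t^k` in `F_m(t)`. -/
def f {A : Type u} [Ring A] [Algebra ℚ A] {n : ℕ} (X : Fin n → A) (W : ℕ → A) (m k : ℕ) : A :=
  PowerSeries.coeff k (F X W m)

/-- `ad_a = [a, ·]` on `A`, with `[a, b] = a b - b a`. -/
abbrev ad {A : Type u} [Ring A] [Algebra ℚ A] (a : A) : Module.End ℚ A :=
  LieAlgebra.ad ℚ A a

end

end Zassenhaus

/-!
Every remainder `R_m` is invertible, and `e^{tX₁} ⋯ e^{tXₙ} e^{t²W₂} ⋯ e^{t^m W_m} R_m` is the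
exponential of the sum `t(X₁ + ⋯ + Xₙ)`. Since the factor with exponent `W_j` is `1 + O(t^j)`, the
factorization converges to that exponential iff `R_m = 1 + O(t^{m+1})` for all `m ≥ 1`
(`isExponents_iff`). This forces `W_{m+1}` to be the coefficient of `t^{m+1}` in `R_m`, which gives
uniqueness, and choosing it so, one `m` after the other, gives existence.

Differentiating `R_m = e^{-u} R_{m-1}` with `u = t^m W_m` gives
`F_m = (e^{-u})' e^u + e^{-u} F_{m-1} e^u`. The first summand is a multiple of `t^{m-1}`, and
conjugation by an exponential is the exponential of `ad` (`coeff_conj_expT`, from the binomial theorem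
for left and right multiplication), so the coefficients of `t^k`, `k ≥ m`, satisfy the recursion, with
one more term, of index `j = ⌊k/m⌋`. That term vanishes because `F_{m-1} = m W_m t^{m-1} + O(t^m)`
(`IsExponents.f_recursion`).

For `k < 2m` the recursion reads `f_{m,k} = f_{m-1,k}`. Going down from `f_{m-1,m-1} = m W_m`, the
index can therefore be lowered for free to `⌊(m-1)/2⌋`. The explicit formulas unroll the recursion
further; the general ones are instances of one identity, `IsExponents.eq_smul_unrolled`. As the
recursion uses only rational combinations and brackets, induction on `m` turns every `f_{m,k}` into
a universal Lie polynomial in the `f_{1,k}` (`isLiePolynomial_f`).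
-/

namespace Zassenhaus

open Filter PowerSeries

/-! ### Exponentials and derivatives of noncommutative power series -/

section Calculus

variable {A : Type u} [Ring A]

lemma coeff_derivT (G : PowerSeries A) (k : ℕ) :
    coeff k (derivT G) = (k + 1) • coeff (k + 1) G := by
  simp [derivT]

/-- The Leibniz rule; the order of the factors matters. -/
lemma derivT_mul (G H : PowerSeries A) :
    derivT (G * H) = derivT G * H + G * derivT H := by
  ext k
  have key : (k + 1) • coeff (k + 1) (G * H) =
      ∑ p ∈ Finset.HasAntidiagonal.antidiagonal (k + 1), (p.1 • coeff p.1 G * coeff p.2 H) +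
      ∑ p ∈ Finset.HasAntidiagonal.antidiagonal (k + 1), (coeff p.1 G * p.2 • coeff p.2 H) := by
    rw [coeff_mul, Finset.smul_sum, ← Finset.sum_add_distrib]
    refine Finset.sum_congr rfl fun p hp => ?_
    rw [← Finset.HasAntidiagonal.mem_antidiagonal.mp hp, add_smul, smul_mul_assoc, mul_smul_comm]
  rw [coeff_derivT, key, Finset.Nat.sum_antidiagonal_succ, Finset.Nat.sum_antidiagonal_succ',
    map_add, coeff_mul, coeff_mul]
  simp [coeff_derivT]

variable [Algebra ℚ A]

lemma coeff_expT (m : ℕ) (a : A) (k : ℕ) :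
    coeff k (expT m a) = if m ∣ k then (1 / ((k / m).factorial : ℚ)) • a ^ (k / m) else 0 := by
  simp [expT]

lemma coeff_zero_expT (m : ℕ) (a : A) : coeff 0 (expT m a) = 1 := by
  simp [expT]

lemma coeff_expT_self {m : ℕ} (hm : 0 < m) (a : A) : coeff m (expT m a) = a := by
  rw [coeff_expT, if_pos dvd_rfl, Nat.div_self hm]; simp

lemma coeff_expT_of_lt {m k : ℕ} (a : A) (hk : 0 < k) (hkm : k < m) :
    coeff k (expT m a) = 0 := by
  rw [coeff_expT, if_neg (Nat.not_dvd_of_pos_of_lt hk hkm)]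

lemma commute_C_expT (m : ℕ) {a b : A} (h : Commute a b) : Commute (C a) (expT m b) := by
  ext k
  rw [coeff_C_mul, coeff_mul_C, coeff_expT]
  split_ifs
  · rw [mul_smul_comm, smul_mul_assoc, (h.pow_right _).eq]
  · simp

/-- `(e^{t^m a})' = m t^{m-1} a e^{t^m a}`. -/
lemma derivT_expT {m : ℕ} (hm : 0 < m) (a : A) :
    derivT (expT m a) = m • (X ^ (m - 1) * (C a * expT m a)) := by
  ext k
  rw [coeff_derivT, map_nsmul, coeff_X_pow_mul', coeff_C_mul, coeff_expT]
  by_cases hd : m ∣ k + 1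
  · obtain ⟨q, hq⟩ := hd
    obtain ⟨q, rfl⟩ : ∃ r, q = r + 1 := Nat.exists_eq_succ_of_ne_zero (by rintro rfl; simp at hq)
    have hk : k - (m - 1) = m * q := by
      have : k + 1 = m * q + m := by rw [hq]; ring
      omega
    have hle : m - 1 ≤ k := by
      have : k + 1 = m * q + m := by rw [hq]; ring
      omega
    rw [hq, if_pos (dvd_mul_right _ _), if_pos hle, hk, coeff_expT, if_pos (dvd_mul_right _ _),
      Nat.mul_div_cancel_left _ hm, Nat.mul_div_cancel_left _ hm, mul_smul_comm, ← pow_succ',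
      ← Nat.cast_smul_eq_nsmul ℚ, ← Nat.cast_smul_eq_nsmul ℚ, smul_smul, smul_smul]
    congr 1
    have : (q.factorial : ℚ) ≠ 0 := by positivity
    have : (q + 1 : ℚ) ≠ 0 := by positivity
    rw [Nat.factorial_succ]
    push_cast
    field_simp
  · rw [if_neg hd, smul_zero]
    split_ifs with hle
    · rw [coeff_expT, if_neg, mul_zero, smul_zero]
      intro h
      refine hd ?_
      have : k + 1 = k - (m - 1) + m := by omega
      rw [this]
      exact dvd_add h dvd_rfl
    · simp

/-- In characteristic zero a power series is determined by its derivative and its constant term. -/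
lemma eq_one_of_derivT_eq_zero {G : PowerSeries A} (h : derivT G = 0) (h0 : coeff 0 G = 1) :
    G = 1 := by
  ext k
  cases k with
  | zero => rw [h0, coeff_zero_one]
  | succ k =>
    have h1 := coeff_derivT G k
    rw [h, map_zero, ← Nat.cast_smul_eq_nsmul ℚ] at h1
    rw [coeff_one, if_neg k.succ_ne_zero]
    exact (smul_eq_zero.mp h1.symm).resolve_left (by positivity)

/-- The product has derivative zero, because `a` commutes with both factors. -/
lemma expT_mul_expT_neg {m : ℕ} (hm : 0 < m) (a : A) : expT m a * expT m (-a) = 1 := by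
  refine eq_one_of_derivT_eq_zero ?_ (by simp [coeff_mul, coeff_zero_expT])
  have h := commute_C_expT m (Commute.refl a)
  rw [derivT_mul, derivT_expT hm, derivT_expT hm, mul_smul_comm, smul_mul_assoc, ← smul_add,
    ← mul_assoc (expT m a), ← X_pow_mul, mul_assoc, mul_assoc, mul_assoc, ← mul_add,
    map_neg, neg_mul, mul_neg, ← mul_assoc (expT m a), ← h.eq, mul_assoc, add_neg_cancel,
    mul_zero, smul_zero]

lemma expT_neg_mul_expT {m : ℕ} (hm : 0 < m) (a : A) : expT m (-a) * expT m a = 1 := by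
  simpa using expT_mul_expT_neg hm (-a)

end Calculus

/-! ### Conjugation by an exponential -/

section Conjugation

lemma sum_range_ite_dvd {M : Type*} [AddCommMonoid M] {m : ℕ} (hm : 0 < m) (k : ℕ) (φ : ℕ → M) :
    ∑ i ∈ Finset.range (k + 1), (if m ∣ i then φ i else 0) =
      ∑ j ∈ Finset.range (k / m + 1), φ (m * j) := by
  rw [← Finset.sum_filter]
  refine Finset.sum_nbij' (· / m) (m * ·) ?_ ?_ ?_ ?_ ?_
  · intro i hi
    simp only [Finset.mem_filter, Finset.mem_range, Nat.lt_succ_iff] at hi ⊢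
    exact Nat.div_le_div_right hi.1
  · intro j hj
    simp only [Finset.mem_filter, Finset.mem_range, Nat.lt_succ_iff] at hj ⊢
    exact ⟨(Nat.mul_le_mul_left m hj).trans (Nat.mul_div_le k m), dvd_mul_right _ _⟩
  · intro i hi
    exact Nat.mul_div_cancel' (Finset.mem_filter.mp hi).2
  · intro j _
    exact Nat.mul_div_cancel_left j hm
  · intro i hi
    rw [Nat.mul_div_cancel' (Finset.mem_filter.mp hi).2]

variable {A : Type u} [Ring A] [Algebra ℚ A]

lemma coeff_expT_mul {m : ℕ} (hm : 0 < m) (a : A) (G : PowerSeries A) (k : ℕ) :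
    coeff k (expT m a * G) = ∑ j ∈ Finset.range (k / m + 1),
      (1 / (j.factorial : ℚ)) • (a ^ j * coeff (k - m * j) G) := by
  rw [coeff_mul, Finset.Nat.sum_antidiagonal_eq_sum_range_succ_mk]
  have h := sum_range_ite_dvd hm k
    fun i => (1 / ((i / m).factorial : ℚ)) • (a ^ (i / m) * coeff (k - i) G)
  simp only [Nat.mul_div_cancel_left _ hm] at h
  rw [← h]
  refine Finset.sum_congr rfl fun i _ => ?_
  rw [coeff_expT]
  split_ifs <;> simp

lemma coeff_mul_expT {m : ℕ} (hm : 0 < m) (a : A) (G : PowerSeries A) (k : ℕ) :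
    coeff k (G * expT m a) = ∑ j ∈ Finset.range (k / m + 1),
      (1 / (j.factorial : ℚ)) • (coeff (k - m * j) G * a ^ j) := by
  rw [coeff_mul, ← Finset.Nat.sum_antidiagonal_swap, Finset.Nat.sum_antidiagonal_eq_sum_range_succ_mk]
  have h := sum_range_ite_dvd hm k
    fun i => (1 / ((i / m).factorial : ℚ)) • (coeff (k - i) G * a ^ (i / m))
  simp only [Nat.mul_div_cancel_left _ hm] at h
  rw [← h]
  refine Finset.sum_congr rfl fun i _ => ?_
  simp only [Prod.fst_swap, Prod.snd_swap]
  rw [coeff_expT]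
  split_ifs <;> simp

/-- The binomial theorem for the commuting operators `x ↦ a x` and `x ↦ -x a`, whose sum
is `ad a`. -/
lemma ad_pow_apply (a x : A) (n : ℕ) :
    ((-1 : ℚ) ^ n / (n.factorial : ℚ)) • (ad a ^ n) x =
      ∑ i ∈ Finset.range (n + 1), (1 / (i.factorial : ℚ)) • (1 / ((n - i).factorial : ℚ)) •
        ((-a) ^ i * x * a ^ (n - i)) := by
  have had : -ad a = LinearMap.mulLeft ℚ (-a) + LinearMap.mulRight ℚ a := by
    ext y
    simp [Ring.lie_def, sub_eq_add_neg, add_comm]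
  have hpow : (-1 : ℚ) ^ n • (ad a ^ n) x = ((-ad a) ^ n) x := by
    rcases Nat.even_or_odd n with h | h
    · simp [h.neg_pow]
    · simp [h.neg_pow]
  rw [div_eq_inv_mul, mul_smul, hpow, had,
    (LinearMap.commute_mulLeft_right (-a) a).add_pow, LinearMap.sum_apply, Finset.smul_sum]
  refine Finset.sum_congr rfl fun i hi => ?_
  have hi' : i ≤ n := Nat.lt_succ_iff.mp (Finset.mem_range.mp hi)
  have happ : (LinearMap.mulLeft ℚ (-a) ^ i * LinearMap.mulRight ℚ a ^ (n - i) *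
      (n.choose i : Module.End ℚ A)) x = (n.choose i : ℚ) • ((-a) ^ i * x * a ^ (n - i)) := by
    rw [LinearMap.pow_mulLeft, LinearMap.pow_mulRight, Module.End.mul_apply, Module.End.mul_apply,
      Module.End.natCast_apply, ← Nat.cast_smul_eq_nsmul ℚ, map_smul, map_smul,
      LinearMap.mulLeft_apply, LinearMap.mulRight_apply, mul_assoc]
  rw [happ, smul_smul, smul_smul, Nat.cast_choose ℚ hi']
  congr 1
  have : (n.factorial : ℚ) ≠ 0 := by positivity
  field_simp

/-- The coefficients of `e^{-t^m a} G e^{t^m a} = e^{-t^m ad a} G`. -/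
lemma coeff_conj_expT {m : ℕ} (hm : 0 < m) (a : A) (G : PowerSeries A) (k : ℕ) :
    coeff k (expT m (-a) * G * expT m a) = ∑ j ∈ Finset.range (k / m + 1),
      ((-1 : ℚ) ^ j / (j.factorial : ℚ)) • (ad a ^ j) (coeff (k - m * j) G) := by
  have hsplit : ∀ i, (k - m * i) / m + 1 = k / m + 1 - i ∨ k / m < i := by
    intro i
    rw [Nat.sub_mul_div]
    omega
  rw [mul_assoc, coeff_expT_mul hm]
  simp only [ad_pow_apply]
  rw [Finset.sum_congr rfl fun n _ => Finset.sum_congr rfl fun i hi => ?_,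
    Finset.sum_range_diag_flip (k / m + 1) fun i j => (1 / (i.factorial : ℚ)) •
      (1 / (j.factorial : ℚ)) • ((-a) ^ i * coeff (k - m * (i + j)) G * a ^ j)]
  · refine Finset.sum_congr rfl fun i hi => ?_
    have hi' : (k - m * i) / m + 1 = k / m + 1 - i :=
      (hsplit i).resolve_right (by have := Finset.mem_range.mp hi; omega)
    rw [coeff_mul_expT hm, hi', Finset.mul_sum, Finset.smul_sum]
    refine Finset.sum_congr rfl fun j _ => ?_
    rw [mul_smul_comm, mul_assoc, Nat.sub_sub, mul_add]
  · rw [Nat.add_sub_cancel' (Nat.lt_succ_iff.mp (Finset.mem_range.mp hi))]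

end Conjugation

/-! ### The remainders `R_m` and the exponents -/

section Remainder

variable {A : Type u} [Ring A]

lemma X_pow_dvd_mul_of_right {k : ℕ} {G : PowerSeries A} (h : X ^ k ∣ G) (H : PowerSeries A) :
    X ^ k ∣ H * G := by
  obtain ⟨K, rfl⟩ := h
  exact ⟨H * K, by rw [← mul_assoc, ← X_pow_mul, mul_assoc]⟩

lemma coeff_eq_of_X_pow_dvd_sub_one {k i : ℕ} {G : PowerSeries A} (h : X ^ k ∣ G - 1)
    (hi : i < k) : coeff i G = if i = 0 then 1 else 0 := by
  rw [← coeff_one, ← sub_eq_zero, ← map_sub]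
  exact X_pow_dvd_iff.mp h i hi

lemma X_pow_dvd_derivT {k : ℕ} {G : PowerSeries A} (h : X ^ (k + 1) ∣ G - 1) :
    X ^ k ∣ derivT G := by
  refine X_pow_dvd_iff.mpr fun i hi => ?_
  rw [coeff_derivT, coeff_eq_of_X_pow_dvd_sub_one h (by omega), if_neg i.succ_ne_zero, smul_zero]

variable [Algebra ℚ A]

lemma isUnit_expT {m : ℕ} (hm : 0 < m) (a : A) : IsUnit (expT m a) :=
  ⟨⟨_, _, expT_mul_expT_neg hm a, expT_neg_mul_expT hm a⟩, rfl⟩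

lemma X_pow_dvd_expT_sub_one (m : ℕ) (a : A) : X ^ m ∣ expT m a - 1 := by
  refine X_pow_dvd_iff.mpr fun i hi => ?_
  rw [map_sub, coeff_one]
  split_ifs with h
  · rw [h, coeff_zero_expT, sub_self]
  · rw [coeff_expT_of_lt a (Nat.pos_of_ne_zero h) hi, sub_zero]

lemma prod_expT_mul_prod_reverse (l : List A) :
    (l.map (expT 1)).prod * (l.map fun a => expT 1 (-a)).reverse.prod = 1 := by
  induction l with
  | nil => simp
  | cons a l ih =>
    rw [List.map_cons, List.map_cons, List.prod_cons, List.reverse_cons, List.prod_append,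
      List.prod_singleton, mul_assoc, ← mul_assoc _ _ (expT 1 (-a)), ih, one_mul,
      expT_mul_expT_neg one_pos]

lemma coeff_one_prod_reverse (l : List A) :
    coeff 0 (l.map fun a => expT 1 (-a)).reverse.prod = 1 ∧
      coeff 1 (l.map fun a => expT 1 (-a)).reverse.prod = -l.sum := by
  induction l with
  | nil => simp [coeff_one]
  | cons a l ih =>
    rw [List.map_cons, List.reverse_cons, List.prod_append, List.prod_singleton]
    constructor
    · simp [coeff_mul, coeff_zero_expT, ih.1]
    · rw [coeff_mul, Finset.Nat.sum_antidiagonal_succ]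
      simp only [Finset.Nat.antidiagonal_zero, Finset.sum_singleton]
      rw [ih.1, zero_add, ih.2, coeff_zero_expT, coeff_expT_self one_pos, List.sum_cons]
      simp [add_comm]

variable {n : ℕ} (Y : Fin n → A) (W : ℕ → A)

-- The data `(X₁, …, Xₙ)` are called `Y` from here on, as `X` is the power series variable.
lemma ofFn_expT : (List.ofFn fun i => expT 1 (Y i)) = (List.ofFn Y).map (expT 1) :=
  by rw [List.map_ofFn]; rfl

lemma ofFn_expT_neg :
    (List.ofFn fun i => expT 1 (-Y i)) = (List.ofFn Y).map fun a => expT 1 (-a) :=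
  by rw [List.map_ofFn]; rfl

lemma isUnit_prod_expT : IsUnit (List.ofFn fun i => expT 1 (Y i)).prod := by
  rw [ofFn_expT]
  induction List.ofFn Y with
  | nil => simp
  | cons a l ih => simpa using (isUnit_expT one_pos a).mul ih

lemma isUnit_partialProd (N : ℕ) :
    IsUnit ((List.range N).map fun j => expT (j + 2) (W (j + 2))).prod := by
  induction List.range N with
  | nil => simp
  | cons a l ih => simpa using (isUnit_expT (Nat.succ_pos _) _).mul ih

/-- The defining property of the remainder: `e^{tX₁} ⋯ e^{tXₙ} e^{t²W₂} ⋯ e^{t^m W_m} R_m` is the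
exponential of the sum. -/
lemma prod_mul_R (N : ℕ) :
    ((List.ofFn fun i => expT 1 (Y i)).prod *
      ((List.range N).map fun j => expT (j + 2) (W (j + 2))).prod) * R Y W (N + 1) =
    expT 1 (∑ i, Y i) := by
  induction N with
  | zero =>
    rw [List.range_zero, List.map_nil, List.prod_nil, mul_one, zero_add, R, ← mul_assoc,
      ofFn_expT, ofFn_expT_neg, prod_expT_mul_prod_reverse, one_mul]
  | succ N ih =>
    rw [← ih, List.range_succ, List.map_append, List.prod_append, List.map_singleton,
      List.prod_singleton, R, mul_assoc, mul_assoc, ← mul_assoc (expT (N + 2) _),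
      expT_mul_expT_neg (Nat.succ_pos _), one_mul, mul_assoc]

lemma R_succ {m : ℕ} (hm : 1 ≤ m) : R Y W (m + 1) = expT (m + 1) (-W (m + 1)) * R Y W m := by
  obtain ⟨m, rfl⟩ := Nat.exists_eq_succ_of_ne_zero (Nat.one_le_iff_ne_zero.mp hm)
  rw [R]

lemma isUnit_R {m : ℕ} (hm : 1 ≤ m) : IsUnit (R Y W m) := by
  obtain ⟨N, rfl⟩ := Nat.exists_eq_succ_of_ne_zero (Nat.one_le_iff_ne_zero.mp hm)
  refine (IsUnit.mul_left_iff ((isUnit_prod_expT Y).mul (isUnit_partialProd W N))).mp ?_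
  rw [Nat.succ_eq_add_one, prod_mul_R]
  exact isUnit_expT one_pos _

/-- The linear terms of `e^{-tXₙ} ⋯ e^{-tX₁}` and `e^{t(X₁+⋯+Xₙ)}` cancel. -/
lemma X_sq_dvd_R_one_sub_one : X ^ 2 ∣ R Y W 1 - 1 := by
  have h := coeff_one_prod_reverse (List.ofFn Y)
  rw [← ofFn_expT_neg] at h
  refine X_pow_dvd_iff.mpr fun i hi => ?_
  rw [R, map_sub, coeff_one, coeff_mul]
  interval_cases i
  · simp only [Finset.Nat.antidiagonal_zero, Finset.sum_singleton]
    rw [h.1, coeff_zero_expT]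
    simp
  · rw [Finset.Nat.sum_antidiagonal_succ]
    simp only [Finset.Nat.antidiagonal_zero, Finset.sum_singleton]
    rw [h.1, zero_add, h.2, coeff_zero_expT, coeff_expT_self one_pos, List.sum_ofFn]
    simp

/-- Later factors `e^{-t^j W_j}`, `j > m`, do not change `R_m` up to order `m`. -/
lemma X_pow_dvd_R_sub_R {m M : ℕ} (hm : 1 ≤ m) (hM : m ≤ M) :
    X ^ (m + 1) ∣ R Y W M - R Y W m := by
  induction M, hM using Nat.le_induction with
  | base => simp
  | succ M hM ih =>
    have h1 : R Y W (M + 1) - R Y W m =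
        (expT (M + 1) (-W (M + 1)) - 1) * R Y W M + (R Y W M - R Y W m) := by
      rw [R_succ Y W (hm.trans hM), sub_mul, one_mul]
      abel
    rw [h1]
    exact dvd_add (((pow_dvd_pow _ (by omega)).trans
      (X_pow_dvd_expT_sub_one _ _)).mul_right _) ih

/-- `W` is a sequence of Zassenhaus exponents iff every remainder satisfies
`R_m = 1 + O(t^{m+1})`. -/
theorem isExponents_iff :
    IsExponents Y W ↔ ∀ m, 1 ≤ m → X ^ (m + 1) ∣ R Y W m - 1 := by
  constructor
  · intro h m hm
    have hev : ∀ᶠ N in atTop, ∀ k ∈ Finset.range (m + 1), _ :=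
      (Filter.eventually_all_finset _).mpr fun k _ => h k
    obtain ⟨N, hN, hmN⟩ := (hev.and (eventually_ge_atTop m)).exists
    have hunit := (isUnit_prod_expT Y).mul (isUnit_partialProd W N)
    have hPR := prod_mul_R Y W N
    obtain ⟨U, hU⟩ := hunit
    rw [← hU] at hPR hN
    have h1 : X ^ (m + 1) ∣ (U : PowerSeries A) * (R Y W (N + 1) - 1) := by
      rw [mul_sub, hPR, mul_one]
      refine X_pow_dvd_iff.mpr fun i hi => ?_
      rw [map_sub, hN i (Finset.mem_range.mpr hi), sub_self]
    have h2 := X_pow_dvd_mul_of_right h1 (↑U⁻¹ : PowerSeries A)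
    rw [Units.inv_mul_cancel_left] at h2
    have h3 := dvd_sub h2 (X_pow_dvd_R_sub_R Y W hm (by omega : m ≤ N + 1))
    simpa using h3
  · intro h k
    filter_upwards [eventually_ge_atTop k] with N hN
    rw [← prod_mul_R Y W N, ← sub_eq_zero, ← map_sub]
    have h1 := X_pow_dvd_mul_of_right (h (N + 1) (by omega))
      ((List.ofFn fun i => expT 1 (Y i)).prod *
        ((List.range N).map fun j => expT (j + 2) (W (j + 2))).prod)
    rw [mul_sub, mul_one] at h1
    rw [← neg_sub, map_neg, X_pow_dvd_iff.mp h1 k (by omega), neg_zero]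

/-- The coefficient of `t^{m+1}` in `R_{m+1} = e^{-t^{m+1} W_{m+1}} R_m`. -/
lemma coeff_expT_neg_mul {m : ℕ} (a : A) {G : PowerSeries A} (h : X ^ (m + 1) ∣ G - 1) :
    coeff (m + 1) (expT (m + 1) (-a) * G) = coeff (m + 1) G - a := by
  have h0 := coeff_eq_of_X_pow_dvd_sub_one h (Nat.succ_pos m)
  rw [if_pos rfl] at h0
  rw [coeff_expT_mul (Nat.succ_pos m), Nat.div_self (Nat.succ_pos m), Finset.sum_range_succ,
    Finset.sum_range_one]
  simp only [mul_zero, Nat.sub_zero, mul_one, Nat.sub_self, h0]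
  simp [sub_eq_add_neg]

/-- `W_{m+1}` is the leading coefficient of `R_m - 1`. -/
lemma IsExponents.eq_coeff_R {Y : Fin n → A} {W : ℕ → A} (h : IsExponents Y W) {m : ℕ}
    (hm : 1 ≤ m) : W (m + 1) = coeff (m + 1) (R Y W m) := by
  rw [isExponents_iff] at h
  have h1 := coeff_eq_of_X_pow_dvd_sub_one (h (m + 1) (by omega)) (Nat.lt_succ_self (m + 1))
  rw [R_succ Y W hm, coeff_expT_neg_mul _ (h m hm), if_neg m.succ_ne_zero, sub_eq_zero] at h1
  exact h1.symm

/-- The remainders, with the leading coefficient of each taken as the next exponent. The index is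
shifted: `greedyR Y m` is `R_{m+1}`, and its leading term has degree `m + 2`. -/
noncomputable def greedyR : ℕ → PowerSeries A
  | 0 => R Y 0 1
  | m + 1 => expT (m + 2) (-coeff (m + 2) (greedyR m)) * greedyR m

theorem exists_isExponents : ∃ W : ℕ → A, IsExponents Y W := by
  have hdvd : ∀ m, X ^ (m + 2) ∣ greedyR Y m - 1 := by
    intro m
    induction m with
    | zero => exact X_sq_dvd_R_one_sub_one Y 0
    | succ m ih =>
      refine X_pow_dvd_iff.mpr fun i hi => ?_
      rw [greedyR]
      rcases Nat.lt_succ_iff_lt_or_eq.mp hi with hi | rfl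
      · have h1 : expT (m + 2) (-coeff (m + 2) (greedyR Y m)) * greedyR Y m - 1 =
            (expT (m + 2) (-coeff (m + 2) (greedyR Y m)) - 1) * greedyR Y m +
              (greedyR Y m - 1) := by
          rw [sub_mul, one_mul]; abel
        rw [h1]
        exact X_pow_dvd_iff.mp (dvd_add ((X_pow_dvd_expT_sub_one _ _).mul_right _) ih) i hi
      · rw [map_sub, coeff_expT_neg_mul _ ih, sub_self, coeff_one, if_neg (by omega), sub_zero]
  refine ⟨fun m => coeff m (greedyR Y (m - 2)), (isExponents_iff Y _).mpr fun m hm => ?_⟩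
  have hR : ∀ m, R Y (fun m => coeff m (greedyR Y (m - 2))) (m + 1) = greedyR Y m := by
    intro m
    induction m with
    | zero => rfl
    | succ m ih => rw [R, ih]; rfl
  obtain ⟨m, rfl⟩ := Nat.exists_eq_succ_of_ne_zero (Nat.one_le_iff_ne_zero.mp hm)
  rw [Nat.succ_eq_add_one, hR]
  exact hdvd m

theorem IsExponents.unique {Y : Fin n → A} {W W' : ℕ → A} (h : IsExponents Y W)
    (h' : IsExponents Y W') {m : ℕ} (hm : 2 ≤ m) : W m = W' m := by
  have hR : ∀ m, 1 ≤ m → R Y W m = R Y W' m := by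
    intro m hm
    induction m, hm using Nat.le_induction with
    | base => rfl
    | succ m hm ih =>
      rw [R_succ _ _ hm, R_succ _ _ hm, h.eq_coeff_R hm, h'.eq_coeff_R hm, ih]
  obtain ⟨m, rfl⟩ := Nat.exists_eq_succ_of_ne_zero (by omega : m ≠ 0)
  rw [Nat.succ_eq_add_one, h.eq_coeff_R (by omega), h'.eq_coeff_R (by omega), hR m (by omega)]

end Remainder

/-! ### The recursion for the logarithmic derivatives -/

section Recursion

variable {A : Type u} [Ring A] [Algebra ℚ A] {n : ℕ} {Y : Fin n → A} {W : ℕ → A}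

/-- `F_{m+1} = (e^{-u})' e^u + e^{-u} F_m e^u` with `u = t^{m+1} W_{m+1}`. -/
lemma F_succ {m : ℕ} (hm : 1 ≤ m) :
    F Y W (m + 1) = derivT (expT (m + 1) (-W (m + 1))) * expT (m + 1) (W (m + 1)) +
      expT (m + 1) (-W (m + 1)) * F Y W m * expT (m + 1) (W (m + 1)) := by
  have hF : F Y W m * R Y W m = derivT (R Y W m) := by
    rw [F, mul_assoc, Ring.inverse_mul_cancel _ (isUnit_R Y W hm), mul_one]
  symm
  change _ = derivT (R Y W (m + 1)) * Ring.inverse (R Y W (m + 1))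
  rw [Ring.eq_mul_inverse_iff_mul_eq _ _ _ (isUnit_R Y W (by omega)), R_succ Y W hm,
    derivT_mul, ← hF, ← mul_assoc, add_mul, mul_assoc _ (expT _ (W _)), mul_assoc _ (expT _ (W _)),
    expT_mul_expT_neg (Nat.succ_pos m), mul_one, mul_one, add_mul, mul_assoc _ (F Y W m)]

lemma f_succ_eq_sum {m k : ℕ} (hm : 1 ≤ m) (hk : m + 1 ≤ k) :
    f Y W (m + 1) k = ∑ j ∈ Finset.range (k / (m + 1) + 1),
      ((-1 : ℚ) ^ j / (j.factorial : ℚ)) • (ad (W (m + 1)) ^ j) (f Y W m (k - (m + 1) * j)) := by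
  rw [f, F_succ hm, map_add, coeff_conj_expT (Nat.succ_pos m), derivT_expT (Nat.succ_pos m),
    smul_mul_assoc, mul_assoc, mul_assoc, expT_neg_mul_expT (Nat.succ_pos m), mul_one, map_nsmul,
    coeff_X_pow_mul', coeff_C]
  have : k - (m + 1 - 1) ≠ 0 := by omega
  simp only [if_neg this, ite_self, smul_zero, zero_add]
  rfl

lemma IsExponents.f_eq_zero (h : IsExponents Y W) {m k : ℕ} (hm : 1 ≤ m) (hk : k < m) :
    f Y W m k = 0 :=
  X_pow_dvd_iff.mp ((X_pow_dvd_derivT ((isExponents_iff Y W).mp h m hm)).mul_right _) k hk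

/-- The leading coefficient of `F_m` is `(m + 1) W_{m+1}`. -/
lemma IsExponents.f_self (h : IsExponents Y W) {m : ℕ} (hm : 1 ≤ m) :
    f Y W m m = ((m + 1 : ℕ) : ℚ) • W (m + 1) := by
  have hR := (isExponents_iff Y W).mp h m hm
  obtain ⟨K, hK⟩ := X_pow_dvd_derivT hR
  have hK0 : coeff 0 K = ((m + 1 : ℕ) : ℚ) • W (m + 1) := by
    have h1 := coeff_derivT (R Y W m) m
    rw [hK, coeff_X_pow_mul', if_pos le_rfl, Nat.sub_self] at h1
    rw [h1, h.eq_coeff_R hm, Nat.cast_smul_eq_nsmul]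
  have hinv : coeff 0 (Ring.inverse (R Y W m)) = 1 := by
    have h1 := congrArg (coeff 0) (Ring.mul_inverse_cancel _ (isUnit_R Y W hm))
    rw [coeff_mul, Finset.Nat.antidiagonal_zero, Finset.sum_singleton,
      coeff_eq_of_X_pow_dvd_sub_one hR (Nat.succ_pos m), if_pos rfl, one_mul, coeff_zero_one] at h1
    exact h1
  rw [f, F, hK, mul_assoc, coeff_X_pow_mul', if_pos le_rfl, Nat.sub_self, coeff_mul,
    Finset.Nat.antidiagonal_zero, Finset.sum_singleton, hK0, hinv, mul_one]

/-- The last term `j = ⌊k/m⌋` of the conjugation series drops out: it involves `f_{m-1,r}` with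
`r = k mod m`, which is zero for `r < m - 1` and a multiple of `W_m` for `r = m - 1`. -/
theorem IsExponents.f_recursion (h : IsExponents Y W) {m k : ℕ} (hm : 2 ≤ m) (hk : m ≤ k) :
    f Y W m k = ∑ j ∈ Finset.range (k / m),
      ((-1 : ℚ) ^ j / (j.factorial : ℚ)) • (ad (W m) ^ j) (f Y W (m - 1) (k - m * j)) := by
  obtain ⟨m, rfl⟩ : ∃ l, m = l + 1 := ⟨m - 1, by omega⟩
  rw [f_succ_eq_sum (by omega) hk, Finset.sum_range_succ, Nat.add_sub_cancel]
  have hmod : k - (m + 1) * (k / (m + 1)) = k % (m + 1) := by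
    have := Nat.div_add_mod k (m + 1); omega
  have hq : 0 < k / (m + 1) := Nat.div_pos hk (Nat.succ_pos m)
  obtain ⟨q, hq⟩ : ∃ q, k / (m + 1) = q + 1 := ⟨k / (m + 1) - 1, by omega⟩
  have hlast : (ad (W (m + 1)) ^ (k / (m + 1))) (f Y W m (k % (m + 1))) = 0 := by
    rcases Nat.lt_succ_iff_lt_or_eq.mp (Nat.mod_lt k (Nat.succ_pos m)) with hr | hr
    · rw [h.f_eq_zero (by omega) hr, map_zero]
    · rw [hr, h.f_self (by omega), map_smul, hq, pow_succ, Module.End.mul_apply,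
        LieAlgebra.ad_apply, lie_self, map_zero, smul_zero]
  rw [hmod, hlast, smul_zero, add_zero]

lemma IsExponents.f_eq_prev (h : IsExponents Y W) {m k : ℕ} (hm : 2 ≤ m) (hk : m ≤ k)
    (hk2 : k < 2 * m) : f Y W m k = f Y W (m - 1) k := by
  have : k / m = 1 := Nat.div_eq_of_lt_le (by omega) (by omega)
  rw [h.f_recursion hm hk, this]
  simp

/-- `f_{m,k}` is constant in `m` on the range `⌊k / 2⌋ ≤ m ≤ k`, `m ≥ 1`. -/
lemma IsExponents.f_eq_of_le (h : IsExponents Y W) {s m k : ℕ} (hs : 1 ≤ s) (hsm : s ≤ m)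
    (hk : m ≤ k) (hk2 : k < 2 * (s + 1)) : f Y W m k = f Y W s k := by
  induction m, hsm using Nat.le_induction with
  | base => rfl
  | succ m hsm ih =>
    rw [h.f_eq_prev (by omega) hk (by omega), Nat.add_sub_cancel, ih (by omega)]

theorem IsExponents.eq_smul_f (h : IsExponents Y W) {m s : ℕ} (hs : 1 ≤ s) (hsm : s ≤ m)
    (hm : m < 2 * (s + 1)) : W (m + 1) = (1 / ((m + 1 : ℕ) : ℚ)) • f Y W s m := by
  rw [← h.f_eq_of_le hs hsm le_rfl hm, h.f_self (by omega), smul_smul, one_div,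
    inv_mul_cancel₀ (by positivity), one_smul]

end Recursion

/-! ### Unrolling the recursion -/

section Unrolling

variable {A : Type u} [Ring A] [Algebra ℚ A] {n : ℕ} {Y : Fin n → A} {W : ℕ → A}

lemma IsExponents.f_eq_sub (h : IsExponents Y W) {m k : ℕ} (hm : 2 ≤ m) (hk : 2 * m ≤ k)
    (hk2 : k < 3 * m) :
    f Y W m k = f Y W (m - 1) k - ad (W m) (f Y W (m - 1) (k - m)) := by
  have : k / m = 2 := Nat.div_eq_of_lt_le (by omega) (by omega)
  rw [h.f_recursion hm (by omega), this]
  simp [Finset.sum_range_succ, sub_eq_add_neg]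

lemma IsExponents.f_eq_sub_add (h : IsExponents Y W) {m k : ℕ} (hm : 2 ≤ m) (hk : 3 * m ≤ k)
    (hk2 : k < 4 * m) :
    f Y W m k = f Y W (m - 1) k - ad (W m) (f Y W (m - 1) (k - m)) +
      (1 / 2 : ℚ) • (ad (W m) ^ 2) (f Y W (m - 1) (k - 2 * m)) := by
  have : k / m = 3 := Nat.div_eq_of_lt_le (by omega) (by omega)
  rw [h.f_recursion hm (by omega), this]
  simp [Finset.sum_range_succ, sub_eq_add_neg, mul_comm m 2]

lemma IsExponents.f_eq_sub_add_sub (h : IsExponents Y W) {m k : ℕ} (hm : 2 ≤ m) (hk : 4 * m ≤ k)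
    (hk2 : k < 5 * m) :
    f Y W m k = f Y W (m - 1) k - ad (W m) (f Y W (m - 1) (k - m)) +
      (1 / 2 : ℚ) • (ad (W m) ^ 2) (f Y W (m - 1) (k - 2 * m)) -
      (1 / 6 : ℚ) • (ad (W m) ^ 3) (f Y W (m - 1) (k - 3 * m)) := by
  have : k / m = 4 := Nat.div_eq_of_lt_le (by omega) (by omega)
  rw [h.f_recursion hm (by omega), this]
  simp [Finset.sum_range_succ, sub_eq_add_neg, mul_comm m 2, mul_comm m 3, Nat.factorial,
    (show (-1 : ℚ) ^ 3 / 6 = -6⁻¹ by norm_num)]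

/-- Going down from `M` to `s` one step at a time, each step contributes only its terms
`j = 0, 1`. -/
lemma IsExponents.f_eq_sub_sum (h : IsExponents Y W) {s M k : ℕ} (hs : 1 ≤ s) (hsM : s ≤ M)
    (hk : 2 * M ≤ k) (hk2 : k < 3 * (s + 1)) :
    f Y W M k = f Y W s k - ∑ p ∈ Finset.Icc (s + 1) M, ad (W p) (f Y W (p - 1) (k - p)) := by
  induction M, hsM using Nat.le_induction with
  | base => simp
  | succ M hsM ih =>
    rw [h.f_eq_sub (by omega) hk (by omega), Nat.add_sub_cancel, ih (by omega),
      Finset.sum_Icc_succ_top (by omega), Nat.add_sub_cancel]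
    abel

/-- The common shape of the general formulas. Here `s = ⌊(m-1)/3⌋`: the step at `s` contributes
its terms `j = 0, 1, 2`, those above `s` contribute `j = 0, 1`, and the inner coefficients
`f_{p-1,m-1-p}` pick up a correction at level `s` exactly when `m - 1 - p ≥ 2 s`. -/
theorem IsExponents.eq_smul_unrolled (h : IsExponents Y W) {m k s M : ℕ} (hm : m = k + 1)
    (hs : 3 ≤ s) (hk : 3 * s ≤ k) (hk2 : k < 3 * (s + 1)) (hM : 2 * M ≤ k)
    (hM2 : k < 2 * (M + 1)) :
    W m = (1 / (m : ℚ)) • (f Y W (s - 1) k - ad (W s) (f Y W (s - 1) (k - s))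
      + (1 / 2 : ℚ) • (ad (W s) ^ 2) (f Y W (s - 1) (k - 2 * s))
      + ∑ p ∈ Finset.Icc (s + 1) (k - 2 * s), ad (W p) (ad (W s) (f Y W (s - 1) (k - p - s)))
      - ∑ p ∈ Finset.Icc (s + 1) M, ad (W p) (f Y W (s - 1) (k - p))) := by
  subst hm
  have hsub : Finset.Icc (s + 1) (k - 2 * s) ⊆ Finset.Icc (s + 1) M :=
    Finset.Icc_subset_Icc le_rfl (by omega)
  have hfilter : (Finset.Icc (s + 1) M).filter (· ≤ k - 2 * s) =
      Finset.Icc (s + 1) (k - 2 * s) := by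
    ext p
    simp only [Finset.mem_filter, Finset.mem_Icc]
    omega
  have hsum : ∑ p ∈ Finset.Icc (s + 1) M, ad (W p) (f Y W (p - 1) (k - p)) =
      ∑ p ∈ Finset.Icc (s + 1) M, ad (W p) (f Y W (s - 1) (k - p)) -
      ∑ p ∈ Finset.Icc (s + 1) (k - 2 * s),
        ad (W p) (ad (W s) (f Y W (s - 1) (k - p - s))) := by
    rw [← hfilter, Finset.sum_filter, ← Finset.sum_sub_distrib]
    refine Finset.sum_congr rfl fun p hp => ?_
    rw [Finset.mem_Icc] at hp
    split_ifs with hpk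
    · rw [h.f_eq_of_le (by omega : 1 ≤ s) (by omega) (by omega) (by omega),
        h.f_eq_sub (by omega) (by omega) (by omega), map_sub]
    · rw [h.f_eq_of_le (by omega : 1 ≤ s - 1) (by omega) (by omega) (by omega), sub_zero]
  rw [h.eq_smul_f (by omega : 1 ≤ M) (by omega) hM2,
    h.f_eq_sub_sum (by omega) (by omega : s ≤ M) hM hk2, h.f_eq_sub_add (by omega) hk (by omega), hsum]
  congr 1
  abel

lemma sum_Icc_eq_head_add {M : Type*} [AddCommMonoid M] {a b : ℕ} (hab : a ≤ b) (φ : ℕ → M) :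
    ∑ p ∈ Finset.Icc a b, φ p = φ a + ∑ p ∈ Finset.Icc (a + 1) b, φ p := by
  rw [← Finset.insert_Icc_add_one_left_eq_Icc hab, Finset.sum_insert (by simp)]

end Unrolling

/-! ### Universal Lie polynomials -/

section Universal

/-- A quantity attached to all data `(A, n, X, W)` of the Zassenhaus formula is a universal Lie
polynomial of `f_{1,1}, …, f_{1,N}` if one element of the free Lie algebra on `N` generators
evaluates to it for all data. -/
def IsLiePolynomial (N : ℕ)
    (g : ∀ (A : Type u) [Ring A] [Algebra ℚ A] (n : ℕ), (Fin n → A) → (ℕ → A) → A) : Prop :=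
  ∃ P : FreeLieAlgebra ℚ (Fin N),
    ∀ (A : Type u) [Ring A] [Algebra ℚ A] (n : ℕ) (X : Fin n → A) (W : ℕ → A),
      IsExponents X W →
        g A n X W = FreeLieAlgebra.lift ℚ (fun i : Fin N => f X W 1 ((i : ℕ) + 1)) P

variable {N : ℕ}
  {g g' : ∀ (A : Type u) [Ring A] [Algebra ℚ A] (n : ℕ), (Fin n → A) → (ℕ → A) → A}

lemma IsLiePolynomial.congr (hg : IsLiePolynomial N g)
    (hgg : ∀ (A : Type u) [Ring A] [Algebra ℚ A] (n : ℕ) (X : Fin n → A) (W : ℕ → A),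
      IsExponents X W → g' A n X W = g A n X W) : IsLiePolynomial N g' := by
  obtain ⟨P, hP⟩ := hg
  exact ⟨P, fun A _ _ n X W h => (hgg A n X W h).trans (hP A n X W h)⟩

lemma isLiePolynomial_zero : IsLiePolynomial.{u} N fun _ _ _ _ _ _ => 0 :=
  ⟨0, fun _ _ _ _ _ _ _ => by simp⟩

lemma IsLiePolynomial.smul (c : ℚ) (hg : IsLiePolynomial N g) :
    IsLiePolynomial N fun A _ _ n X W => c • g A n X W := by
  obtain ⟨P, hP⟩ := hg
  exact ⟨c • P, fun A _ _ n X W h => by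
    beta_reduce; rw [hP A n X W h, map_smul]⟩

lemma IsLiePolynomial.add (hg : IsLiePolynomial N g) (hg' : IsLiePolynomial N g') :
    IsLiePolynomial N fun A _ _ n X W => g A n X W + g' A n X W := by
  obtain ⟨P, hP⟩ := hg
  obtain ⟨P', hP'⟩ := hg'
  exact ⟨P + P', fun A _ _ n X W h => by
    beta_reduce; rw [hP A n X W h, hP' A n X W h, map_add]⟩

lemma IsLiePolynomial.ad (hg : IsLiePolynomial N g) (hg' : IsLiePolynomial N g') :
    IsLiePolynomial N fun A _ _ n X W => Zassenhaus.ad (g A n X W) (g' A n X W) := by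
  obtain ⟨P, hP⟩ := hg
  obtain ⟨P', hP'⟩ := hg'
  exact ⟨⁅P, P'⁆, fun A _ _ n X W h => by
    beta_reduce; rw [hP A n X W h, hP' A n X W h, LieHom.map_lie, LieAlgebra.ad_apply]⟩

lemma IsLiePolynomial.ad_pow (hg : IsLiePolynomial N g) (hg' : IsLiePolynomial N g') (j : ℕ) :
    IsLiePolynomial N fun A _ _ n X W => (Zassenhaus.ad (g A n X W) ^ j) (g' A n X W) := by
  induction j with
  | zero => simpa using hg'
  | succ j ih => simpa only [pow_succ', Module.End.mul_apply] using hg.ad ih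

lemma IsLiePolynomial.sum_range
    {g : ℕ → ∀ (A : Type u) [Ring A] [Algebra ℚ A] (n : ℕ), (Fin n → A) → (ℕ → A) → A}
    (q : ℕ) (hg : ∀ j < q, IsLiePolynomial N (g j)) :
    IsLiePolynomial N fun A _ _ n X W => ∑ j ∈ Finset.range q, g j A n X W := by
  induction q with
  | zero => simpa using isLiePolynomial_zero
  | succ q ih =>
    simp only [Finset.sum_range_succ]
    exact (ih fun j hj => hg j (by omega)).add (hg q (Nat.lt_succ_self q))

lemma isLiePolynomial_of_f_self {m : ℕ} (hm : 1 ≤ m)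
    (hf : IsLiePolynomial.{u} N fun _ _ _ _ X W => f X W m m) :
    IsLiePolynomial.{u} N fun _ _ _ _ _ W => W (m + 1) := by
  refine (hf.smul (1 / ((m + 1 : ℕ) : ℚ))).congr fun A _ _ n X W h => ?_
  rw [h.eq_smul_f hm le_rfl (by omega)]

theorem isLiePolynomial_f {m : ℕ} (hm : 1 ≤ m) {k : ℕ} (hk : k ≤ N) :
    IsLiePolynomial.{u} N fun _ _ _ _ X W => f X W m k := by
  induction m, hm using Nat.le_induction generalizing k with
  | base =>
    cases k with
    | zero => exact isLiePolynomial_zero.congr fun A _ _ n X W h => h.f_eq_zero le_rfl one_pos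
    | succ k =>
      exact ⟨FreeLieAlgebra.of ℚ ⟨k, hk⟩, fun A _ _ n X W _ => by
        rw [FreeLieAlgebra.lift_of_apply]⟩
  | succ m hm ih =>
    rcases lt_or_ge k (m + 1) with hlt | hge
    · exact isLiePolynomial_zero.congr fun A _ _ n X W h => h.f_eq_zero (by omega) hlt
    · have hW := isLiePolynomial_of_f_self hm (ih (by omega : m ≤ N))
      refine (IsLiePolynomial.sum_range (k / (m + 1)) fun j _ =>
        ((hW.ad_pow (ih (k := k - (m + 1) * j) (by omega)) j).smul
          ((-1 : ℚ) ^ j / (j.factorial : ℚ)))).congr fun A _ _ n X W h => ?_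
      exact h.f_recursion (by omega) hge

end Universal

end Zassenhaus

/-! ### The formulas -/

open Zassenhaus in
theorem theorem3p2 :
    -- the exponents of the Zassenhaus formula exist and are unique
    (∀ (A : Type u) [Ring A] [Algebra ℚ A] (n : ℕ) (X : Fin n → A),
      (∃ W : ℕ → A, IsExponents X W) ∧
      ∀ W W' : ℕ → A, IsExponents X W → IsExponents X W' → ∀ m, 2 ≤ m → W m = W' m) ∧
    (∀ (A : Type u) [Ring A] [Algebra ℚ A] (n : ℕ) (X : Fin n → A) (W : ℕ → A),
      IsExponents X W →
      -- the recursion for the coefficients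
      (∀ m k : ℕ, 2 ≤ m → m ≤ k →
        f X W m k = ∑ j ∈ Finset.range (k / m),
          ((-1 : ℚ) ^ j / (j.factorial : ℚ)) • (ad (W m) ^ j) (f X W (m - 1) (k - m * j))) ∧
      (∀ m : ℕ, 5 ≤ m → W m = (1 / (m : ℚ)) • f X W ((m - 1) / 2) (m - 1)) ∧
      -- low degrees
      W 6 = (1 / 6 : ℚ) • (f X W 1 5 - ad (W 2) (f X W 1 3)) ∧
      W 7 = (1 / 7 : ℚ) • (f X W 1 6 - ad (W 2) (f X W 1 4)
        + (1 / 2 : ℚ) • (ad (W 2) ^ 2) (f X W 1 2) - ad (W 3) (f X W 1 3)) ∧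
      W 8 = (1 / 8 : ℚ) • (f X W 1 7 - ad (W 2) (f X W 1 5)
        + (1 / 2 : ℚ) • (ad (W 2) ^ 2) (f X W 1 3) - ad (W 3) (f X W 1 4)
        + ad (W 3) (ad (W 2) (f X W 1 2))) ∧
      W 9 = (1 / 9 : ℚ) • (f X W 1 8 - ad (W 2) (f X W 1 6)
        + (1 / 2 : ℚ) • (ad (W 2) ^ 2) (f X W 1 4)
        - (1 / 6 : ℚ) • (ad (W 2) ^ 3) (f X W 1 2)
        - ad (W 3) (f X W 1 5) + ad (W 3) (ad (W 2) (f X W 1 3))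
        - ad (W 4) (f X W 1 4) + ad (W 4) (ad (W 2) (f X W 1 2))) ∧
      W 10 = (1 / 10 : ℚ) • (f X W 1 9 - ad (W 2) (f X W 1 7)
        + (1 / 2 : ℚ) • (ad (W 2) ^ 2) (f X W 1 5)
        - (1 / 6 : ℚ) • (ad (W 2) ^ 3) (f X W 1 3)
        - ad (W 3) (f X W 1 6) + ad (W 3) (ad (W 2) (f X W 1 4))
        - (1 / 2 : ℚ) • ad (W 3) ((ad (W 2) ^ 2) (f X W 1 2))
        + (1 / 2 : ℚ) • (ad (W 3) ^ 2) (f X W 1 3)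
        - ad (W 4) (f X W 1 5) + ad (W 4) (ad (W 2) (f X W 1 3))) ∧
      -- the general formulas
      ∀ k : ℕ, 2 ≤ k →
        W (6 * k) = (1 / (6 * k : ℚ)) • (f X W (2 * k - 2) (6 * k - 1)
          - ad (W (2 * k - 1)) (f X W (2 * k - 2) (4 * k))
          + (1 / 2 : ℚ) • (ad (W (2 * k - 1)) ^ 2) (f X W (2 * k - 2) (2 * k + 1))
          - ad (W (2 * k)) (f X W (2 * k - 2) (4 * k - 1))
          + ad (W (2 * k)) (ad (W (2 * k - 1)) (f X W (2 * k - 2) (2 * k)))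
          - ad (W (2 * k + 1)) (f X W (2 * k - 2) (4 * k - 2))
          + ad (W (2 * k + 1)) (ad (W (2 * k - 1)) (f X W (2 * k - 2) (2 * k - 1)))
          - ∑ p ∈ Finset.Icc (2 * k + 2) (3 * k - 1),
              ad (W p) (f X W (2 * k - 2) (6 * k - 1 - p))) ∧
        W (6 * k + 1) = (1 / (6 * k + 1 : ℚ)) • (f X W (2 * k - 1) (6 * k)
          - ad (W (2 * k)) (f X W (2 * k - 1) (4 * k))
          + (1 / 2 : ℚ) • (ad (W (2 * k)) ^ 2) (f X W (2 * k - 1) (2 * k))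
          - ad (W (2 * k + 1)) (f X W (2 * k - 1) (4 * k - 1))
          - ∑ p ∈ Finset.Icc (2 * k + 2) (3 * k),
              ad (W p) (f X W (2 * k - 1) (6 * k - p))) ∧
        W (6 * k + 2) = (1 / (6 * k + 2 : ℚ)) • (f X W (2 * k - 1) (6 * k + 1)
          - ad (W (2 * k)) (f X W (2 * k - 1) (4 * k + 1))
          + (1 / 2 : ℚ) • (ad (W (2 * k)) ^ 2) (f X W (2 * k - 1) (2 * k + 1))
          - ad (W (2 * k + 1)) (f X W (2 * k - 1) (4 * k))
          + ad (W (2 * k + 1)) (ad (W (2 * k)) (f X W (2 * k - 1) (2 * k)))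
          - ∑ p ∈ Finset.Icc (2 * k + 2) (3 * k),
              ad (W p) (f X W (2 * k - 1) (6 * k + 1 - p))) ∧
        W (6 * k + 3) = (1 / (6 * k + 3 : ℚ)) • (f X W (2 * k - 1) (6 * k + 2)
          - ad (W (2 * k)) (f X W (2 * k - 1) (4 * k + 2))
          + (1 / 2 : ℚ) • (ad (W (2 * k)) ^ 2) (f X W (2 * k - 1) (2 * k + 2))
          - ad (W (2 * k + 1)) (f X W (2 * k - 1) (4 * k + 1))
          + ad (W (2 * k + 1)) (ad (W (2 * k)) (f X W (2 * k - 1) (2 * k + 1)))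
          - ad (W (2 * k + 2)) (f X W (2 * k - 1) (4 * k))
          + ad (W (2 * k + 2)) (ad (W (2 * k)) (f X W (2 * k - 1) (2 * k)))
          - ∑ p ∈ Finset.Icc (2 * k + 3) (3 * k + 1),
              ad (W p) (f X W (2 * k - 1) (6 * k + 2 - p))) ∧
        W (6 * k + 4) = (1 / (6 * k + 4 : ℚ)) • (f X W (2 * k) (6 * k + 3)
          - ad (W (2 * k + 1)) (f X W (2 * k) (4 * k + 2))
          + (1 / 2 : ℚ) • (ad (W (2 * k + 1)) ^ 2) (f X W (2 * k) (2 * k + 1))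
          - ad (W (2 * k + 2)) (f X W (2 * k) (4 * k + 1))
          - ∑ p ∈ Finset.Icc (2 * k + 3) (3 * k + 1),
              ad (W p) (f X W (2 * k) (6 * k + 3 - p))) ∧
        W (6 * k + 5) = (1 / (6 * k + 5 : ℚ)) • (f X W (2 * k) (6 * k + 4)
          - ad (W (2 * k + 1)) (f X W (2 * k) (4 * k + 3))
          + (1 / 2 : ℚ) • (ad (W (2 * k + 1)) ^ 2) (f X W (2 * k) (2 * k + 2))
          - ad (W (2 * k + 2)) (f X W (2 * k) (4 * k + 2))
          + ad (W (2 * k + 2)) (ad (W (2 * k + 1)) (f X W (2 * k) (2 * k + 1)))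
          - ∑ p ∈ Finset.Icc (2 * k + 3) (3 * k + 2),
              ad (W p) (f X W (2 * k) (6 * k + 4 - p)))) ∧
    -- every exponent is a universal Lie polynomial in `f_{1,1}, …, f_{1,m-1}`
    (∀ m : ℕ, 2 ≤ m → ∃ P : FreeLieAlgebra ℚ (Fin (m - 1)),
      ∀ (A : Type u) [Ring A] [Algebra ℚ A] (n : ℕ) (X : Fin n → A) (W : ℕ → A),
        IsExponents X W →
          W m = FreeLieAlgebra.lift ℚ (fun i : Fin (m - 1) => f X W 1 ((i : ℕ) + 1)) P) := by
  refine ⟨fun A _ _ n X => ⟨exists_isExponents X, fun W W' h h' m hm => h.unique h' hm⟩,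
    fun A _ _ n X W h => ⟨fun m k hm hk => h.f_recursion hm hk, fun m hm => ?_,
      ?_, ?_, ?_, ?_, ?_, fun k hk => ⟨?_, ?_, ?_, ?_, ?_, ?_⟩⟩, fun m hm => ?_⟩
  · obtain ⟨m, rfl⟩ : ∃ l, m = l + 1 := ⟨m - 1, by omega⟩
    rw [Nat.add_sub_cancel]
    exact h.eq_smul_f (by omega) (by omega) (by omega)
  · have h25 := h.f_eq_sub (m := 2) (k := 5) (by omega) (by omega) (by omega)
    have h6 := h.eq_smul_f (m := 5) (s := 2) (by omega) (by omega) (by omega)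
    norm_num at h6 h25 ⊢
    rw [h6, h25]
  · have h36 := h.f_eq_sub (m := 3) (k := 6) (by omega) (by omega) (by omega)
    have h26 := h.f_eq_sub_add (m := 2) (k := 6) (by omega) (by omega) (by omega)
    have h23 := h.f_eq_prev (m := 2) (k := 3) (by omega) (by omega) (by omega)
    have h7 := h.eq_smul_f (m := 6) (s := 3) (by omega) (by omega) (by omega)
    norm_num at h7 h36 h26 h23 ⊢
    rw [h7, h36, h26, h23]
  · have h37 := h.f_eq_sub (m := 3) (k := 7) (by omega) (by omega) (by omega)
    have h27 := h.f_eq_sub_add (m := 2) (k := 7) (by omega) (by omega) (by omega)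
    have h24 := h.f_eq_sub (m := 2) (k := 4) (by omega) (by omega) (by omega)
    have h8 := h.eq_smul_f (m := 7) (s := 3) (by omega) (by omega) (by omega)
    norm_num only [Nat.cast_ofNat] at h8 h37 h27 h24
    rw [h8, h37, h27, h24, map_sub]
    congr 1
    abel
  · have h48 := h.f_eq_sub (m := 4) (k := 8) (by omega) (by omega) (by omega)
    have h38 := h.f_eq_sub (m := 3) (k := 8) (by omega) (by omega) (by omega)
    have h28 := h.f_eq_sub_add_sub (m := 2) (k := 8) (by omega) (by omega) (by omega)
    have h25 := h.f_eq_sub (m := 2) (k := 5) (by omega) (by omega) (by omega)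
    have h34 := h.f_eq_prev (m := 3) (k := 4) (by omega) (by omega) (by omega)
    have h24 := h.f_eq_sub (m := 2) (k := 4) (by omega) (by omega) (by omega)
    have h9 := h.eq_smul_f (m := 8) (s := 4) (by omega) (by omega) (by omega)
    norm_num only [Nat.cast_ofNat] at h9 h48 h38 h28 h25 h34 h24
    rw [h9, h48, h38, h28, h25, h34, h24, map_sub, map_sub]
    congr 1
    abel
  · have h49 := h.f_eq_sub (m := 4) (k := 9) (by omega) (by omega) (by omega)
    have h39 := h.f_eq_sub_add (m := 3) (k := 9) (by omega) (by omega) (by omega)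
    have h29 := h.f_eq_sub_add_sub (m := 2) (k := 9) (by omega) (by omega) (by omega)
    have h26 := h.f_eq_sub_add (m := 2) (k := 6) (by omega) (by omega) (by omega)
    have h23 := h.f_eq_prev (m := 2) (k := 3) (by omega) (by omega) (by omega)
    have h35 := h.f_eq_prev (m := 3) (k := 5) (by omega) (by omega) (by omega)
    have h25 := h.f_eq_sub (m := 2) (k := 5) (by omega) (by omega) (by omega)
    have h10 := h.eq_smul_f (m := 9) (s := 4) (by omega) (by omega) (by omega)
    norm_num only [Nat.cast_ofNat] at h10 h49 h39 h29 h26 h23 h35 h25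
    rw [h10, h49, h39, h29, h26, h23, h35, h25, map_add, map_sub, map_sub, map_smul]
    congr 1
    abel
  -- In the general formulas `s = ⌊(m-1)/3⌋` and `M = ⌊(m-1)/2⌋`; the first one or two terms of the
  -- sum over `p` are written out, the others stay under the sum.
  · have hW := h.eq_smul_unrolled (m := 6 * k) (k := 6 * k - 1) (s := 2 * k - 1) (M := 3 * k - 1)
      (by omega) (by omega) (by omega) (by omega) (by omega) (by omega)
    simp only [(by omega : 2 * k - 1 - 1 = 2 * k - 2),
      (by omega : 6 * k - 1 - (2 * k - 1) = 4 * k),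
      (by omega : 6 * k - 1 - 2 * (2 * k - 1) = 2 * k + 1),
      (by omega : 2 * k - 1 + 1 = 2 * k)] at hW
    rw [sum_Icc_eq_head_add (by omega : 2 * k ≤ 2 * k + 1),
      sum_Icc_eq_head_add (by omega : 2 * k + 1 ≤ 2 * k + 1),
      (by omega : 2 * k + 1 + 1 = 2 * k + 2),
      Finset.Icc_eq_empty (by omega : ¬2 * k + 2 ≤ 2 * k + 1), Finset.sum_empty,
      sum_Icc_eq_head_add (by omega : 2 * k ≤ 3 * k - 1),
      sum_Icc_eq_head_add (by omega : 2 * k + 1 ≤ 3 * k - 1),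
      (by omega : 2 * k + 1 + 1 = 2 * k + 2)] at hW
    simp only [(by omega : 6 * k - 1 - (2 * k) = 4 * k - 1),
      (by omega : 4 * k - 1 - (2 * k - 1) = 2 * k),
      (by omega : 6 * k - 1 - (2 * k + 1) = 4 * k - 2),
      (by omega : 4 * k - 2 - (2 * k - 1) = 2 * k - 1)] at hW
    push_cast at hW
    rw [hW]
    congr 1
    abel
  · have hW := h.eq_smul_unrolled (m := 6 * k + 1) (k := 6 * k) (s := 2 * k) (M := 3 * k)
      (by omega) (by omega) (by omega) (by omega) (by omega) (by omega)
    simp only [(by omega : 6 * k - (2 * k) = 4 * k), (by omega : 6 * k - 2 * (2 * k) = 2 * k)] at hW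
    rw [Finset.Icc_eq_empty (by omega : ¬2 * k + 1 ≤ 2 * k), Finset.sum_empty,
      sum_Icc_eq_head_add (by omega : 2 * k + 1 ≤ 3 * k),
      (by omega : 2 * k + 1 + 1 = 2 * k + 2)] at hW
    simp only [(by omega : 6 * k - (2 * k + 1) = 4 * k - 1)] at hW
    push_cast at hW
    rw [hW]
    congr 1
    abel
  · have hW := h.eq_smul_unrolled (m := 6 * k + 2) (k := 6 * k + 1) (s := 2 * k) (M := 3 * k)
      (by omega) (by omega) (by omega) (by omega) (by omega) (by omega)
    simp only [(by omega : 6 * k + 1 - (2 * k) = 4 * k + 1),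
      (by omega : 6 * k + 1 - 2 * (2 * k) = 2 * k + 1)] at hW
    rw [sum_Icc_eq_head_add (by omega : 2 * k + 1 ≤ 2 * k + 1),
      (by omega : 2 * k + 1 + 1 = 2 * k + 2),
      Finset.Icc_eq_empty (by omega : ¬2 * k + 2 ≤ 2 * k + 1), Finset.sum_empty,
      sum_Icc_eq_head_add (by omega : 2 * k + 1 ≤ 3 * k),
      (by omega : 2 * k + 1 + 1 = 2 * k + 2)] at hW
    simp only [(by omega : 6 * k + 1 - (2 * k + 1) = 4 * k),
      (by omega : 4 * k - (2 * k) = 2 * k)] at hW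
    push_cast at hW
    rw [hW]
    congr 1
    abel
  · have hW := h.eq_smul_unrolled (m := 6 * k + 3) (k := 6 * k + 2) (s := 2 * k) (M := 3 * k + 1)
      (by omega) (by omega) (by omega) (by omega) (by omega) (by omega)
    simp only [(by omega : 6 * k + 2 - (2 * k) = 4 * k + 2),
      (by omega : 6 * k + 2 - 2 * (2 * k) = 2 * k + 2)] at hW
    rw [sum_Icc_eq_head_add (by omega : 2 * k + 1 ≤ 2 * k + 2),
      (by omega : 2 * k + 1 + 1 = 2 * k + 2),
      sum_Icc_eq_head_add (by omega : 2 * k + 2 ≤ 2 * k + 2),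
      (by omega : 2 * k + 2 + 1 = 2 * k + 3),
      Finset.Icc_eq_empty (by omega : ¬2 * k + 3 ≤ 2 * k + 2), Finset.sum_empty,
      sum_Icc_eq_head_add (by omega : 2 * k + 1 ≤ 3 * k + 1),
      (by omega : 2 * k + 1 + 1 = 2 * k + 2),
      sum_Icc_eq_head_add (by omega : 2 * k + 2 ≤ 3 * k + 1),
      (by omega : 2 * k + 2 + 1 = 2 * k + 3)] at hW
    simp only [(by omega : 6 * k + 2 - (2 * k + 1) = 4 * k + 1),
      (by omega : 4 * k + 1 - (2 * k) = 2 * k + 1), (by omega : 6 * k + 2 - (2 * k + 2) = 4 * k),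
      (by omega : 4 * k - (2 * k) = 2 * k)] at hW
    push_cast at hW
    rw [hW]
    congr 1
    abel
  · have hW := h.eq_smul_unrolled (m := 6 * k + 4) (k := 6 * k + 3) (s := 2 * k + 1) (M := 3 * k + 1)
      (by omega) (by omega) (by omega) (by omega) (by omega) (by omega)
    simp only [(by omega : 2 * k + 1 - 1 = 2 * k),
      (by omega : 6 * k + 3 - (2 * k + 1) = 4 * k + 2),
      (by omega : 6 * k + 3 - 2 * (2 * k + 1) = 2 * k + 1),
      (by omega : 2 * k + 1 + 1 = 2 * k + 2)] at hW
    rw [Finset.Icc_eq_empty (by omega : ¬2 * k + 2 ≤ 2 * k + 1), Finset.sum_empty,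
      sum_Icc_eq_head_add (by omega : 2 * k + 2 ≤ 3 * k + 1),
      (by omega : 2 * k + 2 + 1 = 2 * k + 3)] at hW
    simp only [(by omega : 6 * k + 3 - (2 * k + 2) = 4 * k + 1)] at hW
    push_cast at hW
    rw [hW]
    congr 1
    abel
  · have hW := h.eq_smul_unrolled (m := 6 * k + 5) (k := 6 * k + 4) (s := 2 * k + 1) (M := 3 * k + 2)
      (by omega) (by omega) (by omega) (by omega) (by omega) (by omega)
    simp only [(by omega : 2 * k + 1 - 1 = 2 * k),
      (by omega : 6 * k + 4 - (2 * k + 1) = 4 * k + 3),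
      (by omega : 6 * k + 4 - 2 * (2 * k + 1) = 2 * k + 2),
      (by omega : 2 * k + 1 + 1 = 2 * k + 2)] at hW
    rw [sum_Icc_eq_head_add (by omega : 2 * k + 2 ≤ 2 * k + 2),
      (by omega : 2 * k + 2 + 1 = 2 * k + 3),
      Finset.Icc_eq_empty (by omega : ¬2 * k + 3 ≤ 2 * k + 2), Finset.sum_empty,
      sum_Icc_eq_head_add (by omega : 2 * k + 2 ≤ 3 * k + 2),
      (by omega : 2 * k + 2 + 1 = 2 * k + 3)] at hW
    simp only [(by omega : 6 * k + 4 - (2 * k + 2) = 4 * k + 2),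
      (by omega : 4 * k + 2 - (2 * k + 1) = 2 * k + 1)] at hW
    push_cast at hW
    rw [hW]
    congr 1
    abel
  · obtain ⟨m, rfl⟩ : ∃ l, m = l + 1 := ⟨m - 1, by omega⟩
    exact isLiePolynomial_of_f_self (by omega) (isLiePolynomial_f (by omega) le_rfl)
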